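/- Let $X$ be a finite connected simplicial complex whose fundamental group is amenable, i.e. there is a positive linear functional $\mu\colon L^\infty(\pi_1(X))\to\mathbb R$ on the bounded functions with $\mu(1)=1$ that is invariant under left translations. Let $p\colon\widetilde X\to X$ be the universal cover with the lifted simplicial structure. A (smooth) differential form on a simplicial complex is a collection of smooth forms on the closed simplices that is compatible with restriction to faces; the exterior derivative is taken on each simplex. A Riemannian metric on a simplicial complex is a collection of smooth Riemannian metrics on the closed simplices that is compatible with restriction to faces. A $k$-form is bounded with respect to a metric if its values on orthonormal $k$-tuples of tangent vectors are bounded, uniformly over all points of all simplices. A closed $k$-form $\eta$ on $X$ is a de Rham representative of $\alpha\in H^k(X;\mathbb R)$ if the simplicial cocycle $\sigma\mapsto\int_\sigma\eta$ represents $\alpha$. Let $g$ be a Riemannian metric on $X$ and let $\widetilde g=p^*g$. For $k\ge 0$, a class $\alpha\in H^k(X;\mathbb R)$ is called hyperbolic if it has a de Rham representative $\eta$ such that $p^*\eta=d\beta$ for some $(k-1)$-form $\beta$ on $\widetilde X$ that is bounded with respect to $\widetilde g$ (for $k=0$, where there are no nonzero $(k-1)$-forms, this means $p^*\eta=0$).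 Then, for every $k\ge 0$ and every such $g$, every hyperbolic class $\alpha\in H^k(X;\mathbb R)$ is zero. -/

import Mathlib

open scoped ContDiff

noncomputable section

/-! ### Amenable groups -/

/-- The real vector space `L^∞(G)` of bounded functions on a (discrete) group. -/
def boundedFunctions (G : Type*) : Submodule ℝ (G → ℝ) where
  carrier := {f | ∃ C : ℝ, ∀ x, |f x| ≤ C}
  zero_mem' := ⟨0, fun x => by simp⟩
  add_mem' := by
    rintro f g ⟨C, hC⟩ ⟨D, hD⟩
    exact ⟨C + D, fun x => (abs_add_le _ _).trans (add_le_add (hC x) (hD x))⟩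
  smul_mem' := by
    rintro c f ⟨C, hC⟩
    refine ⟨|c| * C, fun x => ?_⟩
    simpa [abs_mul] using mul_le_mul_of_nonneg_left (hC x) (abs_nonneg c)

/-- Left translation of a bounded function: `(g · f)(x) = f (g⁻¹ x)`. -/
def leftTranslate {G : Type*} [Group G] (g : G) (f : boundedFunctions G) : boundedFunctions G :=
  ⟨fun x => f.1 (g⁻¹ * x), f.2.imp fun _ h x => h (g⁻¹ * x)⟩

/-- The constant function `1`, as a bounded function. -/
def boundedOne (G : Type*) : boundedFunctions G :=
  ⟨fun _ => 1, 1, fun _ => by simp⟩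

/-- A group is amenable if it admits a left-invariant mean. -/
def IsAmenable (G : Type*) [Group G] : Prop :=
  ∃ m : boundedFunctions G →ₗ[ℝ] ℝ,
    m (boundedOne G) = 1 ∧
    (∀ f : boundedFunctions G, (∀ x, 0 ≤ f.1 x) → 0 ≤ m f) ∧
    ∀ (g : G) (f : boundedFunctions G), m (leftTranslate g f) = m f

/-! ### Model simplices

The standard `n`-simplex is taken in the coordinates `x₁, …, xₙ` (the barycentric coordinates
other than the zeroth one), so that it has non-empty interior in `ℝⁿ`. -/

/-- The `n`-simplex `{x ∈ ℝⁿ | 0 ≤ xᵢ, ∑ xᵢ ≤ 1}`. -/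
def modelSimplex (n : ℕ) : Set (Fin n → ℝ) :=
  {x | (∀ i, 0 ≤ x i) ∧ ∑ i, x i ≤ 1}

/-- The vertices of the model simplex: the origin, followed by the standard basis vectors. -/
def modelVertex (n : ℕ) : Fin (n + 1) → (Fin n → ℝ) :=
  Fin.cons 0 fun i => Pi.single i 1

/-- The linear part of the affine map `modelMap f`. -/
def modelMapLinear {m n : ℕ} (f : Fin (m + 1) → Fin (n + 1)) : (Fin m → ℝ) →L[ℝ] (Fin n → ℝ) :=
  ∑ i : Fin m, (ContinuousLinearMap.proj (R := ℝ) (φ := fun _ : Fin m => ℝ) i).smulRight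
    (modelVertex n (f i.succ) - modelVertex n (f 0))

/-- The affine map between model simplices that sends the `i`-th vertex to the `f i`-th one. -/
def modelMap {m n : ℕ} (f : Fin (m + 1) → Fin (n + 1)) (x : Fin m → ℝ) : Fin n → ℝ :=
  modelVertex n (f 0) + modelMapLinear f x

namespace AbstractSimplicialComplex

/-! ### Ordered simplices and simplicial cohomology -/

/-- An `n`-simplex of `K` together with an ordering of its `n + 1` vertices. -/
structure OrderedSimplex {V : Type*} (K : AbstractSimplicialComplex V) (n : ℕ) where
  vert : Fin (n + 1) ↪ V
  mem : Finset.univ.map vert ∈ K.faces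

/-- The face (or the reordering) of an ordered simplex given by an injective map of vertices. -/
def OrderedSimplex.face {V : Type*} {K : AbstractSimplicialComplex V} {m n : ℕ}
    (e : K.OrderedSimplex n) (f : Fin (m + 1) ↪ Fin (n + 1)) : K.OrderedSimplex m where
  vert := f.trans e.vert
  mem := by
    refine (K.isRelLowerSet_faces e.mem).2 (fun v hv => ?_) ⟨e.vert (f 0), by simp⟩
    simp only [Finset.mem_map, Finset.mem_univ, true_and] at hv ⊢
    obtain ⟨i, rfl⟩ := hv
    exact ⟨f i, rfl⟩

/-- Real simplicial `k`-cochains: functions on ordered `k`-simplices that change by the sign of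
the permutation when the vertices are reordered. -/
def cochains {V : Type*} (K : AbstractSimplicialComplex V) (k : ℕ) :
    Submodule ℝ (K.OrderedSimplex k → ℝ) where
  carrier := {c | ∀ (e : K.OrderedSimplex k) (s : Equiv.Perm (Fin (k + 1))),
    c (e.face s.toEmbedding) = ((Equiv.Perm.sign s : ℤ) : ℝ) * c e}
  zero_mem' := fun _ _ => by simp
  add_mem' := fun {a b} ha hb e s => by simp [ha e s, hb e s, mul_add]
  smul_mem' := fun r a ha e s => by simp [ha e s, mul_left_comm]

/-- The simplicial coboundary `(δ c)(v₀, …, vₖ₊₁) = ∑ᵢ (-1)ⁱ c(v₀, …, v̂ᵢ, …, vₖ₊₁)`. -/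
def coboundary {V : Type*} (K : AbstractSimplicialComplex V) (k : ℕ) :
    (K.OrderedSimplex k → ℝ) →ₗ[ℝ] (K.OrderedSimplex (k + 1) → ℝ) where
  toFun c e := ∑ i : Fin (k + 2), (-1 : ℝ) ^ (i : ℕ) * c (e.face (Fin.succAboveEmb i))
  map_add' a b := by
    funext e
    simp [mul_add, Finset.sum_add_distrib]
  map_smul' r a := by
    funext e
    simp [Finset.mul_sum, mul_left_comm]

/-- Simplicial `k`-cocycles. -/
def cocycles {V : Type*} (K : AbstractSimplicialComplex V) (k : ℕ) :
    Submodule ℝ (K.OrderedSimplex k → ℝ) :=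
  K.cochains k ⊓ LinearMap.ker (K.coboundary k)

/-- Simplicial `k`-coboundaries; there are no non-zero ones in degree `0`. -/
def coboundaries {V : Type*} (K : AbstractSimplicialComplex V) :
    (k : ℕ) → Submodule ℝ (K.OrderedSimplex k → ℝ)
  | 0 => ⊥
  | k + 1 => (K.cochains k).map (K.coboundary k)

/-- The simplicial cohomology `H^k(K; ℝ)`: cocycles modulo coboundaries. -/
abbrev Cohomology {V : Type*} (K : AbstractSimplicialComplex V) (k : ℕ) : Type _ :=
  K.cocycles k ⧸ (K.coboundaries k).submoduleOf (K.cocycles k)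

/-- The cohomology class of a cocycle. -/
def cohomologyClass {V : Type*} (K : AbstractSimplicialComplex V) (k : ℕ) (a : K.cocycles k) :
    K.Cohomology k :=
  Submodule.Quotient.mk a

/-! ### Differential forms and metrics on a simplicial complex -/

/-- A smooth differential `k`-form on a simplicial complex: a smooth form on every closed simplex
(read in the coordinates given by any ordering of the vertices), compatible with restriction to
faces and with reordering of the vertices. Only the values on the closed model simplices matter. -/
structure DiffForm {V : Type*} (K : AbstractSimplicialComplex V) (k : ℕ) where
  form : ∀ {n : ℕ}, K.OrderedSimplex n → (Fin n → ℝ) → (Fin n → ℝ) [⋀^Fin k]→L[ℝ] ℝ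
  smooth : ∀ {n : ℕ} (e : K.OrderedSimplex n), ContDiffOn ℝ ∞ (form e) (modelSimplex n)
  compatible : ∀ {m n : ℕ} (e : K.OrderedSimplex n) (f : Fin (m + 1) ↪ Fin (n + 1)),
    ∀ x ∈ modelSimplex m,
      form (e.face f) x = (form e (modelMap f x)).compContinuousLinearMap (modelMapLinear f)

/-- A Riemannian metric on a simplicial complex: a smooth Riemannian metric on every closed
simplex, compatible with restriction to faces and with reordering of the vertices. -/
structure Metric {V : Type*} (K : AbstractSimplicialComplex V) where
  inner : ∀ {n : ℕ}, K.OrderedSimplex n →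
    (Fin n → ℝ) → (Fin n → ℝ) →L[ℝ] (Fin n → ℝ) →L[ℝ] ℝ
  smooth : ∀ {n : ℕ} (e : K.OrderedSimplex n), ContDiffOn ℝ ∞ (inner e) (modelSimplex n)
  symm : ∀ {n : ℕ} (e : K.OrderedSimplex n), ∀ x ∈ modelSimplex n,
    ∀ v w, inner e x v w = inner e x w v
  pos : ∀ {n : ℕ} (e : K.OrderedSimplex n), ∀ x ∈ modelSimplex n,
    ∀ v, v ≠ 0 → 0 < inner e x v v
  compatible : ∀ {m n : ℕ} (e : K.OrderedSimplex n) (f : Fin (m + 1) ↪ Fin (n + 1)),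
    ∀ x ∈ modelSimplex m, ∀ v w,
      inner (e.face f) x v w = inner e (modelMap f x) (modelMapLinear f v) (modelMapLinear f w)

namespace DiffForm

/-- The exterior derivative of `β` on every simplex is `η`. -/
def IsPrimitive {V : Type*} {K : AbstractSimplicialComplex V} {k : ℕ}
    (β : K.DiffForm k) (η : K.DiffForm (k + 1)) : Prop :=
  ∀ {n : ℕ} (e : K.OrderedSimplex n), ∀ x ∈ modelSimplex n,
    extDerivWithin (β.form e) (modelSimplex n) x = η.form e x

/-- The exterior derivative of `η` vanishes on every simplex. -/
def IsClosedForm {V : Type*} {K : AbstractSimplicialComplex V} {k : ℕ} (η : K.DiffForm k) : Prop :=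
  ∀ {n : ℕ} (e : K.OrderedSimplex n), ∀ x ∈ modelSimplex n,
    extDerivWithin (η.form e) (modelSimplex n) x = 0

/-- A form is bounded with respect to a metric if its values on orthonormal tuples of tangent
vectors are bounded uniformly over all points of all simplices. -/
def IsBounded {V : Type*} {K : AbstractSimplicialComplex V} {k : ℕ} (g : K.Metric)
    (η : K.DiffForm k) : Prop :=
  ∃ C : ℝ, ∀ {n : ℕ} (e : K.OrderedSimplex n), ∀ x ∈ modelSimplex n,
    ∀ v : Fin k → (Fin n → ℝ), (∀ i j, g.inner e x (v i) (v j) = if i = j then 1 else 0) →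
      |η.form e x v| ≤ C

/-- `η` is the exterior derivative of a bounded form. There are no non-zero forms of degree `-1`,
so in degree `0` this means `η = 0`. -/
def HasBoundedPrimitive {V : Type*} {K : AbstractSimplicialComplex V} (g : K.Metric) :
    {k : ℕ} → K.DiffForm k → Prop
  | 0, η => ∀ {n : ℕ} (e : K.OrderedSimplex n), ∀ x ∈ modelSimplex n, η.form e x = 0
  | k + 1, η => ∃ β : K.DiffForm k, β.IsPrimitive η ∧ β.IsBounded g

/-- The integral of a `k`-form over an ordered `k`-simplex, oriented by the ordering. -/
def integral {V : Type*} {K : AbstractSimplicialComplex V} {k : ℕ} (η : K.DiffForm k)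
    (e : K.OrderedSimplex k) : ℝ :=
  ∫ x in modelSimplex k, η.form e x fun i => Pi.single i 1

/-- `η` is a de Rham representative of the class `α`: it is closed, and integration of `η` over
simplices is a cocycle in the class `α`. -/
def Represents {V : Type*} {K : AbstractSimplicialComplex V} {k : ℕ} (η : K.DiffForm k)
    (α : K.Cohomology k) : Prop :=
  η.IsClosedForm ∧ ∃ a : K.cocycles k, a.1 = η.integral ∧ K.cohomologyClass k a = α

end DiffForm

/-! ### Geometric realization -/

/-- The geometric realization of a finite simplicial complex, in barycentric coordinates, with
the subspace topology from `ℝ^V`. -/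
abbrev Realization {V : Type*} [Fintype V] (K : AbstractSimplicialComplex V) : Type _ :=
  {x : V → ℝ // (∀ v, 0 ≤ x v) ∧ ∑ v, x v = 1 ∧ ∃ s ∈ K.faces, ∀ v, v ∉ s → x v = 0}

/-- The point of the realization given by a vertex. -/
def vertexPoint {V : Type*} [Fintype V] [DecidableEq V] (K : AbstractSimplicialComplex V) (v : V) :
    K.Realization :=
  ⟨Pi.single v 1, fun w => by
      by_cases h : w = v
      · subst h; simp
      · simp [h],
    by simp, {v}, K.singleton_mem v, fun w hw => by
      simp only [Finset.mem_singleton] at hw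
      simp [hw]⟩

/-- The straight path from `v` to `w` along an edge (constant if `v = w`). -/
def edgePath {V : Type*} [Fintype V] [DecidableEq V] (K : AbstractSimplicialComplex V) {v w : V}
    (h : {v, w} ∈ K.faces) : Path (K.vertexPoint v) (K.vertexPoint w) where
  toFun t := ⟨fun u => (1 - (t : ℝ)) * (K.vertexPoint v).1 u + (t : ℝ) * (K.vertexPoint w).1 u,
    fun u => add_nonneg
      (mul_nonneg (sub_nonneg.2 t.2.2) ((K.vertexPoint v).2.1 u))
      (mul_nonneg t.2.1 ((K.vertexPoint w).2.1 u)),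
    by
      rw [Finset.sum_add_distrib, ← Finset.mul_sum, ← Finset.mul_sum, (K.vertexPoint v).2.2.1,
        (K.vertexPoint w).2.2.1]
      ring,
    {v, w}, h, fun u hu => by
      simp only [Finset.mem_insert, Finset.mem_singleton, not_or] at hu
      simp [vertexPoint, hu.1, hu.2]⟩
  continuous_toFun := by
    refine Continuous.subtype_mk (continuous_pi fun u => ?_) _
    fun_prop
  source' := by ext u; simp
  target' := by ext u; simp

/-! ### The universal cover -/

/-- The vertices of the universal cover with respect to a base point `x₀`: the points of the
universal cover (homotopy classes of paths in the realization that start at `x₀`) that lie over a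
vertex. -/
structure CoverVertex {V : Type*} [Fintype V] [DecidableEq V] (K : AbstractSimplicialComplex V)
    (x₀ : K.Realization) where
  base : V
  path : Path.Homotopic.Quotient x₀ (K.vertexPoint base)

/-- The universal cover of a connected finite simplicial complex, with the lifted simplicial
structure: a finite set of vertices spans a simplex if it lies bijectively over a simplex of `K`
and is the vertex set of a lift of that simplex, i.e. any two of its vertices are joined by the
lift of the edge between their projections. -/
def universalCover {V : Type*} [Fintype V] [DecidableEq V] (K : AbstractSimplicialComplex V)
    (x₀ : K.Realization) : AbstractSimplicialComplex (K.CoverVertex x₀) where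
  faces := {t | Set.InjOn CoverVertex.base (t : Set (K.CoverVertex x₀)) ∧
    t.image CoverVertex.base ∈ K.faces ∧
    ∀ a ∈ t, ∀ b ∈ t, ∃ h : {a.base, b.base} ∈ K.faces,
      b.path = a.path.trans (Path.Homotopic.Quotient.mk (K.edgePath h))}
  isRelLowerSet_faces := by
    rintro t ⟨hinj, hmem, hedge⟩
    refine ⟨Finset.image_nonempty.1 (K.isRelLowerSet_faces hmem).1, fun s hst hs => ?_⟩
    exact ⟨hinj.mono (by exact_mod_cast hst),
      (K.isRelLowerSet_faces hmem).2 (Finset.image_subset_image hst) (hs.image _),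
      fun a ha b hb => hedge a (hst ha) b (hst hb)⟩
  singleton_mem := by
    intro a
    have h : {a.base, a.base} ∈ K.faces := by simpa using K.singleton_mem a.base
    have hrefl : K.edgePath h = Path.refl _ := by
      ext t u
      change (1 - (t : ℝ)) * (K.vertexPoint a.base).1 u + (t : ℝ) * (K.vertexPoint a.base).1 u = _
      simp only [Path.refl_apply]
      ring
    refine ⟨by simp, by simpa using K.singleton_mem a.base, fun b hb c hc => ?_⟩
    obtain rfl := Finset.mem_singleton.1 hb
    obtain rfl := Finset.mem_singleton.1 hc
    refine ⟨h, ?_⟩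
    rw [hrefl]
    simp

/-- The image of an ordered simplex under the covering projection. -/
def OrderedSimplex.proj {V : Type*} [Fintype V] [DecidableEq V] {K : AbstractSimplicialComplex V}
    {x₀ : K.Realization} {n : ℕ} (e : (K.universalCover x₀).OrderedSimplex n) :
    K.OrderedSimplex n where
  vert := ⟨fun i => (e.vert i).base, fun i j hij =>
    e.vert.injective (e.mem.1 (by simp) (by simp) hij)⟩
  mem := by
    have h := e.mem.2.1
    convert h using 1
    ext v
    simp only [Finset.mem_map, Finset.mem_univ, true_and, Finset.mem_image, exists_exists_eq_and]
    rfl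

/-- The pull-back `p^* η` of a form to the universal cover. -/
def DiffForm.pullback {V : Type*} [Fintype V] [DecidableEq V] {K : AbstractSimplicialComplex V}
    {k : ℕ} (η : K.DiffForm k) (x₀ : K.Realization) : (K.universalCover x₀).DiffForm k where
  form e := η.form e.proj
  smooth e := η.smooth e.proj
  compatible e f := η.compatible e.proj f

/-- The pull-back of a metric to the universal cover. -/
def Metric.pullback {V : Type*} [Fintype V] [DecidableEq V] {K : AbstractSimplicialComplex V}
    (g : K.Metric) (x₀ : K.Realization) : (K.universalCover x₀).Metric where
  inner e := g.inner e.proj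
  smooth e := g.smooth e.proj
  symm e := g.symm e.proj
  pos e := g.pos e.proj
  compatible e f := g.compatible e.proj f

/-- A class is hyperbolic if it has a de Rham representative whose pull-back to the universal cover
has a primitive that is bounded with respect to the pulled back metric. -/
def IsHyperbolic {V : Type*} [Fintype V] [DecidableEq V] {K : AbstractSimplicialComplex V}
    (x₀ : K.Realization) (g : K.Metric) {k : ℕ} (α : K.Cohomology k) : Prop :=
  ∃ η : K.DiffForm k, η.Represents α ∧ (η.pullback x₀).HasBoundedPrimitive (g.pullback x₀)

end AbstractSimplicialComplex

end

/-! By Stokes' theorem, integrating a bounded primitive of `p^* η` over the simplices of the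
universal cover gives a simplicial cochain whose coboundary is the pull-back of the cocycle `∫ η`.
That cochain is bounded, because the `g`-volumes of the finitely many simplices of `X` are.
Averaging a bounded cochain over the lifts of each simplex with an invariant mean commutes with the
coboundary and is left inverse to the pull-back, so `∫ η` is a coboundary on `X`.

A lift of a simplex is determined by the lift of its zeroth vertex `v`, that is, by a path class
from `x₀` to `v`; invariance makes the mean transported from the fundamental group to these path
classes independent of all choices. -/

noncomputable section

open MeasureTheory AbstractSimplicialComplex

section Alternating

variable {R M N ι : Type*}

lemma alternating_cons_add [CommRing R] [AddCommGroup M] [Module R M] [AddCommGroup N] [Module R N]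
    {k : ℕ} (a : M [⋀^Fin (k + 1)]→ₗ[R] N) (x : M) (v : Fin k → M) :
    a (Fin.cons x fun i => v i + x) = a (Fin.cons x v) := by
  change a.curryLeft x (v + fun _ => x) = a.curryLeft x v
  rw [AlternatingMap.map_add_univ, Finset.sum_eq_single_of_mem Finset.univ (Finset.mem_univ _),
    Finset.piecewise_univ]
  intro s _ hs
  obtain ⟨i, hi⟩ : ∃ i, i ∉ s := by simpa [Finset.eq_univ_iff_forall] using hs
  exact a.map_eq_zero_of_eq _ (i := 0) (j := i.succ) (by simp [hi]) (Fin.succ_ne_zero i).symm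

lemma alternating_sub_zero [CommRing R] [AddCommGroup M] [Module R M] [AddCommGroup N] [Module R N]
    {k : ℕ} (a : M [⋀^Fin k]→ₗ[R] N) (v : Fin (k + 1) → M) :
    (a fun i => v i.succ - v 0) = ∑ j : Fin (k + 1), (-1 : R) ^ (j : ℕ) • a (j.removeNth v) := by
  -- `b` is the wedge product of `a` with the coordinate on the second factor. Both sides are its
  -- value at the points `(v j, 1)`, on the left after subtracting the zeroth one from the others.
  let b : (M × R) [⋀^Fin (k + 1)]→ₗ[R] N := AlternatingMap.alternatizeUncurryFin
    ((LinearMap.snd R M R).smulRight (a.compLinearMap (LinearMap.fst R M R)))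
  have hb (w : Fin (k + 1) → M × R) : b w =
      ∑ j : Fin (k + 1), (-1 : R) ^ (j : ℕ) • (w j).2 • a fun i => (j.removeNth w i).1 := by
    rw [AlternatingMap.alternatizeUncurryFin_apply]
    simp [← Int.cast_smul_eq_zsmul R]
  have hcons := alternating_cons_add b (v 0, 1) fun i => (v i.succ - v 0, 0)
  have hv : (Fin.cons (v 0, 1) fun i : Fin k => (v i.succ - v 0, (0 : R)) + (v 0, 1) :
      Fin (k + 1) → M × R) = fun j => (v j, 1) := by
    funext j
    refine Fin.cases rfl (fun i => ?_) j
    simp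
  rw [hv, hb, hb, Fin.sum_univ_succ (n := k)
    (f := fun j => _ • ((Fin.cons _ _ : Fin (k + 1) → M × R) j).2 • _)] at hcons
  simp only [one_smul, Fin.val_zero, pow_zero, Fin.cons_zero, Fin.removeNth_zero, Fin.tail_cons,
    Fin.cons_succ, zero_smul, smul_zero, Finset.sum_const_zero, add_zero] at hcons
  exact hcons.symm

lemma alternating_eq_det_mul [CommRing R] [Fintype ι] [DecidableEq ι]
    (a : (ι → R) [⋀^ι]→ₗ[R] R) (w : ι → ι → R) :
    a w = (Matrix.of w).det * a fun i => Pi.single i 1 := by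
  have hbasis : ⇑(Pi.basisFun R ι) = fun i => Pi.single i 1 := funext (Pi.basisFun_apply R ι)
  conv_lhs => rw [a.eq_smul_basis_det (Pi.basisFun R ι)]
  rw [AlternatingMap.smul_apply, Pi.basisFun_det_apply, smul_eq_mul, mul_comm, hbasis]

lemma det_cons_one [CommRing R] {k : ℕ} (w : Fin (k + 1) → Fin k → R) :
    (Matrix.of fun i => (Fin.cons 1 (w i) : Fin (k + 1) → R)).det =
      (Matrix.of fun i : Fin k => w i.succ - w 0).det := by
  rw [Matrix.det_succ_column_zero]
  refine Eq.trans ?_ (alternating_sub_zero Matrix.detRowAlternating w).symm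
  refine Finset.sum_congr rfl fun i _ => ?_
  simp only [Matrix.of_apply, Fin.cons_zero, mul_one]
  rfl

lemma exists_orthonormal_family {E : Type*} [AddCommGroup E] [Module ℝ E] [FiniteDimensional ℝ E]
    {B : LinearMap.BilinForm ℝ E} (hsymm : LinearMap.IsSymm B) (hpos : ∀ v, v ≠ 0 → 0 < B v v)
    {n : ℕ} (hn : Module.finrank ℝ E = n) :
    ∃ w : Fin n → E, ∀ i j, B (w i) (w j) = if i = j then 1 else 0 := by
  subst hn
  obtain ⟨v, hv⟩ := LinearMap.BilinForm.exists_orthogonal_basis hsymm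
  refine ⟨fun i => (√(B (v i) (v i)))⁻¹ • v i, fun i j => ?_⟩
  simp only [map_smul, LinearMap.smul_apply, smul_eq_mul]
  split_ifs with hij
  · subst hij
    have hvi : 0 < B (v i) (v i) := hpos (v i) (v.ne_zero i)
    have hsq := Real.sq_sqrt hvi.le
    field_simp
    exact hsq.symm
  · have : B (v i) (v j) = 0 := hv hij
    rw [this, mul_zero, mul_zero]

lemma abs_alternating_single_le {k : ℕ} (a : (Fin k → ℝ) [⋀^Fin k]→ₗ[ℝ] ℝ)
    {B : LinearMap.BilinForm ℝ (Fin k → ℝ)} (hsymm : LinearMap.IsSymm B)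
    (hpos : ∀ v, v ≠ 0 → 0 < B v v)
    {C : ℝ} (hC : ∀ v : Fin k → Fin k → ℝ, (∀ i j, B (v i) (v j) = if i = j then 1 else 0) →
      |a v| ≤ C) :
    |a fun i => Pi.single i 1| ≤ √(LinearMap.BilinForm.toMatrix' B).det * C := by
  obtain ⟨w, hw⟩ := exists_orthonormal_family hsymm hpos (Module.finrank_fin_fun ℝ)
  set W : Matrix (Fin k) (Fin k) ℝ := Matrix.of w
  set G := LinearMap.BilinForm.toMatrix' B
  have hWG : W * G * W.transpose = 1 := by
    rw [LinearMap.BilinForm.mul_toMatrix'_mul]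
    ext i j
    rw [LinearMap.BilinForm.toMatrix'_apply, LinearMap.BilinForm.comp_apply, Matrix.toLin'_apply,
      Matrix.toLin'_apply, Matrix.mulVec_single_one, Matrix.mulVec_single_one, Matrix.one_apply]
    exact hw i j
  have hdet : W.det ^ 2 * G.det = 1 := by
    rw [← Matrix.det_one (n := Fin k), ← hWG, Matrix.det_mul, Matrix.det_mul, Matrix.det_transpose]
    ring
  have hW : √G.det * |W.det| = 1 := by
    rw [← Real.sqrt_sq_eq_abs, ← Real.sqrt_mul' _ (sq_nonneg _), mul_comm, hdet, Real.sqrt_one]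
  calc |a fun i => Pi.single i 1| = √G.det * |a w| := by
        rw [alternating_eq_det_mul a w, abs_mul, ← mul_assoc, hW, one_mul]
    _ ≤ √G.det * C := mul_le_mul_of_nonneg_left (hC w hw) (Real.sqrt_nonneg _)

end Alternating

section ModelSimplex

variable {k m n p : ℕ} {F : Type*} [NormedAddCommGroup F] [NormedSpace ℝ F]

lemma modelVertex_zero (n : ℕ) : modelVertex n 0 = 0 := rfl

lemma modelVertex_succ (i : Fin n) : modelVertex n i.succ = Pi.single i 1 := rfl

lemma modelMapLinear_apply (f : Fin (m + 1) → Fin (n + 1)) (x : Fin m → ℝ) :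
    modelMapLinear f x = ∑ i, x i • (modelVertex n (f i.succ) - modelVertex n (f 0)) := by
  simp [modelMapLinear]

lemma modelMapLinear_single (f : Fin (m + 1) → Fin (n + 1)) (i : Fin m) :
    modelMapLinear f (Pi.single i 1) = modelVertex n (f i.succ) - modelVertex n (f 0) := by
  rw [modelMapLinear_apply, Finset.sum_eq_single i] <;> simp +contextual

lemma modelMap_modelVertex (f : Fin (m + 1) → Fin (n + 1)) (i : Fin (m + 1)) :
    modelMap f (modelVertex m i) = modelVertex n (f i) := by
  refine Fin.cases ?_ (fun i => ?_) i
  · simp [modelMap, modelVertex_zero]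
  · simp [modelMap, modelVertex_succ, modelMapLinear_single]

lemma modelMapLinear_modelMapLinear (f : Fin (m + 1) → Fin (n + 1)) (h : Fin (n + 1) → Fin (p + 1))
    (x : Fin m → ℝ) : modelMapLinear h (modelMapLinear f x) = modelMapLinear (h ∘ f) x := by
  have hedge (i j : Fin (n + 1)) : modelMapLinear h (modelVertex n i - modelVertex n j) =
      modelVertex p (h i) - modelVertex p (h j) := by
    rw [← modelMap_modelVertex h i, ← modelMap_modelVertex h j, map_sub, modelMap, modelMap,
      add_sub_add_left_eq_sub]
  simp only [modelMapLinear_apply f, modelMapLinear_apply (h ∘ f), map_sum, map_smul, hedge,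
    Function.comp_apply]

lemma modelMap_modelMap (f : Fin (m + 1) → Fin (n + 1)) (h : Fin (n + 1) → Fin (p + 1))
    (x : Fin m → ℝ) : modelMap h (modelMap f x) = modelMap (h ∘ f) x := by
  have hvertex := modelMap_modelVertex h (f 0)
  rw [modelMap] at hvertex
  rw [modelMap, modelMap, map_add, ← add_assoc, hvertex, modelMapLinear_modelMapLinear, modelMap,
    Function.comp_apply]

lemma modelMap_id (x : Fin n → ℝ) : modelMap id x = x := by
  rw [modelMap, modelMapLinear_apply]
  ext j
  simp [modelVertex_zero, modelVertex_succ, Pi.single_apply]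

lemma continuous_modelMap (f : Fin (m + 1) → Fin (n + 1)) : Continuous (modelMap f) :=
  continuous_const.add (modelMapLinear f).continuous

lemma convex_modelSimplex (n : ℕ) : Convex ℝ (modelSimplex n) := by
  rintro x ⟨hx, hx'⟩ y ⟨hy, hy'⟩ a b ha hb hab
  refine ⟨fun i => add_nonneg (mul_nonneg ha (hx i)) (mul_nonneg hb (hy i)), ?_⟩
  simp only [Pi.add_apply, Pi.smul_apply, smul_eq_mul, Finset.sum_add_distrib, ← Finset.mul_sum]
  nlinarith

lemma modelVertex_mem_modelSimplex (i : Fin (n + 1)) : modelVertex n i ∈ modelSimplex n := by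
  refine Fin.cases ?_ (fun i => ?_) i
  · simp [modelSimplex, modelVertex_zero]
  · refine ⟨fun j => ?_, by simp [modelVertex_succ]⟩
    rw [modelVertex_succ, Pi.single_apply]
    split_ifs <;> norm_num

lemma modelMap_eq_sum_smul_modelVertex (f : Fin (m + 1) → Fin (n + 1)) (x : Fin m → ℝ) :
    modelMap f x = ∑ i, (Fin.cons (1 - ∑ i, x i) x : Fin (m + 1) → ℝ) i • modelVertex n (f i) := by
  simp only [Fin.sum_univ_succ, modelMap, modelMapLinear_apply, Fin.cons_zero, Fin.cons_succ,
    smul_sub, sub_smul, one_smul, Finset.sum_sub_distrib, ← Finset.sum_smul]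
  abel

lemma mapsTo_modelMap (f : Fin (m + 1) → Fin (n + 1)) :
    Set.MapsTo (modelMap f) (modelSimplex m) (modelSimplex n) := by
  intro x hx
  rw [modelMap_eq_sum_smul_modelVertex]
  refine (convex_modelSimplex n).sum_mem (fun i _ => ?_) (by simp [Fin.sum_univ_succ])
    fun _ _ => modelVertex_mem_modelSimplex _
  refine Fin.cases ?_ (fun i => ?_) i
  · simpa using hx.2
  · simpa using hx.1 i

lemma isCompact_modelSimplex (n : ℕ) : IsCompact (modelSimplex n) := by
  refine (isCompact_Icc (a := (0 : Fin n → ℝ)) (b := 1)).of_isClosed_subset ?_ ?_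
  · simp only [modelSimplex, Set.ofPred_and, Set.ofPred_forall]
    exact (isClosed_iInter fun i => isClosed_le continuous_const (continuous_apply i)).inter
      (isClosed_le (by fun_prop) continuous_const)
  · rintro x ⟨h0, h1⟩
    exact ⟨h0, fun i => (Finset.single_le_sum (fun j _ => h0 j) (Finset.mem_univ i)).trans h1⟩

lemma measurableSet_modelSimplex (n : ℕ) : MeasurableSet (modelSimplex n) :=
  (isCompact_modelSimplex n).measurableSet

lemma uniqueDiffOn_modelSimplex (n : ℕ) : UniqueDiffOn ℝ (modelSimplex n) := by
  have hopen : IsOpen {x : Fin n → ℝ | (∀ i, 0 < x i) ∧ ∑ i, x i < 1} := by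
    simp only [Set.ofPred_and, Set.ofPred_forall]
    exact (isOpen_iInter_of_finite fun i => isOpen_lt continuous_const (continuous_apply i)).inter
      (isOpen_lt (by fun_prop) continuous_const)
  have hsub : {x : Fin n → ℝ | (∀ i, 0 < x i) ∧ ∑ i, x i < 1} ⊆ modelSimplex n :=
    fun x hx => ⟨fun i => (hx.1 i).le, hx.2.le⟩
  refine uniqueDiffOn_convex (convex_modelSimplex n) ⟨fun _ => ((n : ℝ) + 1)⁻¹,
    interior_maximal hsub hopen ⟨fun _ => by positivity, ?_⟩⟩
  rw [Finset.sum_const, Finset.card_univ, Fintype.card_fin, nsmul_eq_mul,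
    mul_inv_lt_iff₀ (by positivity)]
  linarith

lemma det_modelMapLinear_single (s : Equiv.Perm (Fin (k + 1))) :
    (Matrix.of fun i => modelMapLinear s (Pi.single i 1)).det = ((Equiv.Perm.sign s : ℤ) : ℝ) := by
  let A : Matrix (Fin (k + 1)) (Fin (k + 1)) ℝ := Matrix.of fun i => Fin.cons 1 (modelVertex k i)
  have hone : A.det = 1 := by
    refine (det_cons_one (modelVertex k)).trans (Eq.trans (congrArg Matrix.det ?_) Matrix.det_one)
    ext i j
    simp [modelVertex_zero, modelVertex_succ, Matrix.one_apply, Pi.single_apply, eq_comm]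
  simp only [modelMapLinear_single]
  calc (Matrix.of fun i : Fin k => modelVertex k (s i.succ) - modelVertex k (s 0)).det
      = (A.submatrix s id).det := (det_cons_one fun i => modelVertex k (s i)).symm
    _ = ((Equiv.Perm.sign s : ℤ) : ℝ) := by rw [Matrix.det_permute, hone, mul_one]

lemma alternating_modelMapLinear_perm (a : (Fin k → ℝ) [⋀^Fin k]→ₗ[ℝ] ℝ)
    (s : Equiv.Perm (Fin (k + 1))) :
    (a fun i => modelMapLinear s (Pi.single i 1)) =
      ((Equiv.Perm.sign s : ℤ) : ℝ) * a fun i => Pi.single i 1 := by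
  rw [alternating_eq_det_mul, det_modelMapLinear_single]

lemma abs_det_modelMapLinear_perm (s : Equiv.Perm (Fin (k + 1))) :
    |(modelMapLinear s).det| = 1 := by
  have hdet : (modelMapLinear s).det = ((Equiv.Perm.sign s : ℤ) : ℝ) := by
    rw [ContinuousLinearMap.det, ← LinearMap.det_toMatrix', ← Matrix.det_transpose,
      ← det_modelMapLinear_single]
    rfl
  rw [hdet, ← Int.cast_abs, Int.isUnit_iff_abs_eq.1 (Equiv.Perm.sign s).isUnit, Int.cast_one]

lemma setIntegral_comp_modelMap_perm (s : Equiv.Perm (Fin (k + 1))) (b : (Fin k → ℝ) → F) :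
    ∫ x in modelSimplex k, b (modelMap s x) = ∫ x in modelSimplex k, b x := by
  have hleft (s : Equiv.Perm (Fin (k + 1))) :
      Function.LeftInverse (modelMap s.symm) (modelMap s) := fun x => by
    rw [modelMap_modelMap, Equiv.symm_comp_self, modelMap_id]
  have himage : modelMap s '' modelSimplex k = modelSimplex k :=
    (mapsTo_modelMap s).image_subset.antisymm fun x hx =>
      ⟨modelMap s.symm x, mapsTo_modelMap _ hx, hleft s.symm x⟩
  have hchange := integral_image_eq_integral_abs_det_fderiv_smul volume
    (measurableSet_modelSimplex k) (f := modelMap s) (f' := fun _ => modelMapLinear s)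
    (fun x _ => ((modelMapLinear s).hasFDerivAt.const_add _).hasFDerivWithinAt)
    (hleft s).injective.injOn b
  simpa only [himage, abs_det_modelMapLinear_perm, one_smul] using hchange.symm

end ModelSimplex

section Stokes

variable {k n : ℕ}

lemma insertNth_mem_modelSimplex_iff (j : Fin (k + 1)) (t : ℝ) (y : Fin k → ℝ) :
    (j.insertNth t y : Fin (k + 1) → ℝ) ∈ modelSimplex (k + 1) ↔
      y ∈ modelSimplex k ∧ t ∈ Set.Icc 0 (1 - ∑ i, y i) := by
  simp only [modelSimplex, Set.mem_ofPred_eq, Fin.sum_univ_succAbove _ j, Set.mem_Icc,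
    Fin.forall_iff_succAbove j, Fin.insertNth_apply_same, Fin.insertNth_apply_succAbove]
  constructor
  · rintro ⟨⟨ht, hy⟩, hsum⟩
    exact ⟨⟨hy, by linarith⟩, ht, by linarith⟩
  · rintro ⟨⟨hy, -⟩, ht, hsum⟩
    exact ⟨⟨ht, hy⟩, by linarith⟩

lemma integrableOn_comp_modelMap {E : Type*} [NormedAddCommGroup E] {b : (Fin n → ℝ) → E}
    (hb : ContinuousOn b (modelSimplex n)) (f : Fin (k + 1) → Fin (n + 1)) :
    IntegrableOn (fun y => b (modelMap f y)) (modelSimplex k) :=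
  (hb.comp (continuous_modelMap f).continuousOn (mapsTo_modelMap f)).integrableOn_compact
    (isCompact_modelSimplex k)

variable {F : Type*} [NormedAddCommGroup F] [NormedSpace ℝ F]

lemma setIntegral_modelSimplex_succ (j : Fin (k + 1)) {b : (Fin (k + 1) → ℝ) → F}
    (hb : ContinuousOn b (modelSimplex (k + 1))) :
    ∫ x in modelSimplex (k + 1), b x =
      ∫ y in modelSimplex k, ∫ t in (0 : ℝ)..(1 - ∑ i, y i), b (j.insertNth t y) := by
  let S := modelSimplex (k + 1)
  have hmp : MeasurePreserving (MeasurableEquiv.piFinSuccAbove (fun _ : Fin (k + 1) => ℝ) j).symm :=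
    (volume_preserving_piFinSuccAbove (fun _ : Fin (k + 1) => ℝ) j).symm _
  have hint : Integrable (S.indicator b) :=
    (hb.integrableOn_compact (isCompact_modelSimplex _)).integrable_indicator
      (measurableSet_modelSimplex _)
  have hslice (y : Fin k → ℝ) : ∫ t, S.indicator b (j.insertNth t y) =
      (modelSimplex k).indicator
        (fun y => ∫ t in (0 : ℝ)..(1 - ∑ i, y i), b (j.insertNth t y)) y := by
    classical
    simp only [Set.indicator_apply, S, insertNth_mem_modelSimplex_iff]
    split_ifs with hy
    · rw [intervalIntegral.integral_of_le (by linarith [hy.2]), ← integral_Icc_eq_integral_Ioc,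
        ← integral_indicator measurableSet_Icc]
      simp only [hy, true_and, Set.indicator_apply]
    · simp only [hy, false_and, if_false, integral_zero]
  calc ∫ x in S, b x = ∫ x, S.indicator b x :=
        (integral_indicator (measurableSet_modelSimplex _)).symm
    _ = ∫ z : ℝ × (Fin k → ℝ), S.indicator b (j.insertNth z.1 z.2) :=
        (hmp.integral_comp' _).symm
    _ = ∫ y, ∫ t, S.indicator b (j.insertNth t y) :=
        integral_prod_symm _ (hmp.integrable_comp_of_integrable hint)
    _ = _ := by
        simp only [hslice]
        exact integral_indicator (measurableSet_modelSimplex k)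

lemma hasDerivAt_insertNth (j : Fin (k + 1)) (y : Fin k → ℝ) (t : ℝ) :
    HasDerivAt (fun t : ℝ => (j.insertNth t y : Fin (k + 1) → ℝ)) (Pi.single j 1) t := by
  refine hasDerivAt_pi.2 fun i => ?_
  refine Fin.succAboveCases j ?_ (fun i => ?_) i
  · simpa using hasDerivAt_id' t
  · simpa using hasDerivAt_const t (y i)

lemma continuousOn_fderivWithin_modelSimplex {b : (Fin n → ℝ) → F}
    (hb : ContDiffOn ℝ 1 b (modelSimplex n)) (v : Fin n → ℝ) :
    ContinuousOn (fun x => fderivWithin ℝ b (modelSimplex n) x v) (modelSimplex n) :=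
  (hb.continuousOn_fderivWithin (uniqueDiffOn_modelSimplex n) le_rfl).clm_apply continuousOn_const

lemma setIntegral_partialDeriv_modelSimplex [CompleteSpace F] (j : Fin (k + 1))
    {b : (Fin (k + 1) → ℝ) → F} (hb : ContDiffOn ℝ 1 b (modelSimplex (k + 1))) :
    ∫ x in modelSimplex (k + 1), fderivWithin ℝ b (modelSimplex (k + 1)) x (Pi.single j 1) =
      ∫ y in modelSimplex k, (b (j.insertNth (1 - ∑ i, y i) y) - b (j.insertNth 0 y)) := by
  have hderiv := continuousOn_fderivWithin_modelSimplex hb (Pi.single j 1)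
  rw [setIntegral_modelSimplex_succ j hderiv]
  refine setIntegral_congr_fun (measurableSet_modelSimplex k) fun y hy => ?_
  have hle : (0 : ℝ) ≤ 1 - ∑ i, y i := sub_nonneg.2 hy.2
  have hmaps : Set.MapsTo (fun t : ℝ => (j.insertNth t y : Fin (k + 1) → ℝ))
      (Set.Icc 0 (1 - ∑ i, y i)) (modelSimplex (k + 1)) :=
    fun t ht => (insertNth_mem_modelSimplex_iff j t y).2 ⟨hy, ht⟩
  have hcont : Continuous fun t : ℝ => (j.insertNth t y : Fin (k + 1) → ℝ) :=
    continuous_iff_continuousAt.2 fun t => (hasDerivAt_insertNth j y t).continuousAt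
  refine intervalIntegral.integral_eq_sub_of_hasDerivAt_of_le hle
    (hb.continuousOn.comp hcont.continuousOn hmaps) (fun t ht => ?_)
    ((hderiv.comp hcont.continuousOn hmaps).intervalIntegrable_of_Icc hle)
  have hfderiv := (hb.differentiableOn one_ne_zero _ (hmaps ⟨ht.1.le, ht.2.le⟩)).hasFDerivWithinAt
  exact (hfderiv.comp_hasDerivWithinAt t (hasDerivAt_insertNth j y t).hasDerivWithinAt
    hmaps).hasDerivAt (Icc_mem_nhds ht.1 ht.2)

lemma modelMap_succAbove_succ (j : Fin (k + 1)) (y : Fin k → ℝ) :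
    modelMap j.succ.succAbove y = j.insertNth 0 y := by
  rw [modelMap, modelMapLinear_apply]
  ext i
  refine Fin.succAboveCases j ?_ (fun i => ?_) i <;>
    simp [modelVertex_zero, modelVertex_succ, Pi.single_apply]

lemma modelMapLinear_succAbove_succ_single (j : Fin (k + 1)) (i : Fin k) :
    modelMapLinear j.succ.succAbove (Pi.single i 1) = Pi.single (j.succAbove i) 1 := by
  simp [modelMapLinear_single, modelVertex_zero, modelVertex_succ]

lemma modelMap_succ_cycleRange_symm (j : Fin (k + 1)) (y : Fin k → ℝ) :
    modelMap (Fin.succ ∘ j.cycleRange.symm) y = j.insertNth (1 - ∑ i, y i) y := by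
  rw [modelMap, modelMapLinear_apply]
  ext i
  refine Fin.succAboveCases j ?_ (fun i => ?_) i <;>
    simp [modelVertex_succ, Pi.single_apply, sub_eq_add_neg]

lemma setIntegral_insertNth_one_sub_sum (j : Fin (k + 1)) (b : (Fin (k + 1) → ℝ) → F) :
    ∫ y in modelSimplex k, b (j.insertNth (1 - ∑ i, y i) y) =
      ∫ y in modelSimplex k, b (modelMap Fin.succ y) := by
  -- The two parametrizations of the face `∑ xᵢ = 1` differ by a permutation of its vertices.
  rw [← setIntegral_comp_modelMap_perm j.cycleRange.symm fun y => b (modelMap Fin.succ y)]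
  simp only [modelMap_modelMap, modelMap_succ_cycleRange_symm]

lemma contDiffOn_alternating_apply {E : Type*} [NormedAddCommGroup E] [NormedSpace ℝ E] {G : Type*}
    [NormedAddCommGroup G] [NormedSpace ℝ G] {ι : Type*} [Fintype ι] {r : WithTop ℕ∞}
    {β : G → E [⋀^ι]→L[ℝ] F} {s : Set G} (hβ : ContDiffOn ℝ r β s) (v : ι → E) :
    ContDiffOn ℝ r (fun x => β x v) s :=
  (ContinuousAlternatingMap.apply ℝ E F v).contDiff.comp_contDiffOn hβ

variable {β : (Fin (k + 1) → ℝ) → (Fin (k + 1) → ℝ) [⋀^Fin k]→L[ℝ] F}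

lemma setIntegral_zeroth_face (hβ : ContinuousOn β (modelSimplex (k + 1))) :
    ∫ y in modelSimplex k,
        β (modelMap Fin.succ y) (fun l => modelMapLinear Fin.succ (Pi.single l 1)) =
      ∑ j : Fin (k + 1), (-1 : ℝ) ^ (j : ℕ) • ∫ y in modelSimplex k,
        β (j.insertNth (1 - ∑ i, y i) y) fun l => Pi.single (j.succAbove l) 1 := by
  have hsplit (x : Fin (k + 1) → ℝ) : (β x fun l => modelMapLinear Fin.succ (Pi.single l 1)) =
      ∑ j : Fin (k + 1), (-1 : ℝ) ^ (j : ℕ) • β x fun l => Pi.single (j.succAbove l) 1 := by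
    simp only [modelMapLinear_single]
    exact alternating_sub_zero (β x).toAlternatingMap fun i => modelVertex (k + 1) i.succ
  have hint (j : Fin (k + 1)) : IntegrableOn
      (fun y => β (modelMap Fin.succ y) fun l => Pi.single (j.succAbove l) 1) (modelSimplex k) :=
    integrableOn_comp_modelMap (b := fun x => β x fun l => Pi.single (j.succAbove l) 1)
      ((ContinuousAlternatingMap.apply ℝ _ F _).continuous.comp_continuousOn hβ) Fin.succ
  simp only [hsplit]
  rw [integral_finsetSum _ fun j _ => (hint j).fun_smul _]
  refine Finset.sum_congr rfl fun j _ => ?_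
  rw [setIntegral_insertNth_one_sub_sum j fun x => β x fun l => Pi.single (j.succAbove l) 1,
    integral_smul]

lemma setIntegral_extDerivWithin_modelSimplex (hβ : ContDiffOn ℝ 1 β (modelSimplex (k + 1))) :
    ∫ x in modelSimplex (k + 1),
        extDerivWithin β (modelSimplex (k + 1)) x (fun i => Pi.single i 1) =
      ∑ j : Fin (k + 1), (-1 : ℝ) ^ (j : ℕ) • ∫ x in modelSimplex (k + 1),
        fderivWithin ℝ (fun x => β x fun l => Pi.single (j.succAbove l) 1)
          (modelSimplex (k + 1)) x (Pi.single j 1) := by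
  have hint (j : Fin (k + 1)) : IntegrableOn (fun x =>
      fderivWithin ℝ (fun x => β x fun l => Pi.single (j.succAbove l) 1) (modelSimplex (k + 1)) x
        (Pi.single j 1)) (modelSimplex (k + 1)) :=
    (continuousOn_fderivWithin_modelSimplex (contDiffOn_alternating_apply hβ _)
      _).integrableOn_compact (isCompact_modelSimplex _)
  have hsum : Set.EqOn
      (fun x => extDerivWithin β (modelSimplex (k + 1)) x (fun i => Pi.single i 1))
      (fun x => ∑ j : Fin (k + 1), (-1 : ℝ) ^ (j : ℕ) •
        fderivWithin ℝ (fun x => β x fun l => Pi.single (j.succAbove l) 1)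
          (modelSimplex (k + 1)) x (Pi.single j 1)) (modelSimplex (k + 1)) := fun x hx => by
    simp only [extDerivWithin_apply (hβ.differentiableOn one_ne_zero x hx)
      (uniqueDiffOn_modelSimplex _ x hx), ← Int.cast_smul_eq_zsmul ℝ, Int.cast_pow, Int.cast_neg,
      Int.cast_one]
    rfl
  rw [setIntegral_congr_fun (measurableSet_modelSimplex _) hsum,
    integral_finsetSum _ fun j _ => (hint j).fun_smul _]
  simp only [integral_smul]

theorem stokes_modelSimplex [CompleteSpace F] (hβ : ContDiffOn ℝ 1 β (modelSimplex (k + 1))) :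
    ∫ x in modelSimplex (k + 1),
        extDerivWithin β (modelSimplex (k + 1)) x (fun i => Pi.single i 1) =
      ∑ i : Fin (k + 2), (-1 : ℝ) ^ (i : ℕ) • ∫ y in modelSimplex k,
        β (modelMap i.succAbove y) fun l => modelMapLinear i.succAbove (Pi.single l 1) := by
  have hcoeff (j : Fin (k + 1)) :=
    contDiffOn_alternating_apply hβ fun l => Pi.single (j.succAbove l) 1
  have hint (j : Fin (k + 1)) (f : Fin (k + 1) → Fin (k + 2)) :=
    integrableOn_comp_modelMap (hcoeff j).continuousOn f
  rw [setIntegral_extDerivWithin_modelSimplex hβ, Fin.sum_univ_succ (n := k + 1),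
    Fin.succAbove_zero, setIntegral_zeroth_face hβ.continuousOn, Fin.val_zero, pow_zero, one_smul,
    ← Finset.sum_add_distrib]
  refine Finset.sum_congr rfl fun j _ => ?_
  rw [setIntegral_partialDeriv_modelSimplex j (hcoeff j)]
  simp only [← modelMap_succ_cycleRange_symm, ← modelMap_succAbove_succ]
  rw [integral_sub (hint j _) (hint j _)]
  simp only [modelMapLinear_succAbove_succ_single, Fin.val_succ, pow_succ, mul_neg, mul_one,
    neg_smul, smul_add, smul_neg, sub_eq_add_neg]

end Stokes

section Averaging

open Path

/-- Composition with a map `φ`, as a linear map between spaces of bounded functions. -/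
def boundedComp {A B : Type*} (φ : A → B) : boundedFunctions B →ₗ[ℝ] boundedFunctions A where
  toFun f := ⟨fun a => f.1 (φ a), f.2.imp fun _ h a => h (φ a)⟩
  map_add' _ _ := rfl
  map_smul' _ _ := rfl

variable {X : Type*} [TopologicalSpace X] {x₀ y z : X}
  (m : boundedFunctions (FundamentalGroup X x₀) →ₗ[ℝ] ℝ)

/-- The mean on the path classes from `x₀` to `y` obtained by transporting `m` along the bijection
`γ ↦ γ · p` from the fundamental group. -/
def meanAlong (p : Homotopic.Quotient x₀ y) :
    boundedFunctions (Homotopic.Quotient x₀ y) →ₗ[ℝ] ℝ :=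
  m ∘ₗ boundedComp fun γ => Homotopic.Quotient.trans γ p

variable {m}

lemma meanAlong_trans (p : Homotopic.Quotient x₀ y) (q : Homotopic.Quotient y z)
    (f : boundedFunctions (Homotopic.Quotient x₀ z)) :
    meanAlong m (p.trans q) f = meanAlong m p (boundedComp (fun r => r.trans q) f) := by
  refine congrArg m (Subtype.ext (funext fun γ => congrArg f.1 ?_))
  exact (Homotopic.Quotient.trans_assoc _ _ _).symm

lemma meanAlong_eq_meanAlong (hinv : ∀ γ f, m (leftTranslate γ f) = m f)
    (p q : Homotopic.Quotient x₀ y) : meanAlong m p = meanAlong m q := by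
  ext f
  let d : FundamentalGroup X x₀ := p.trans q.symm
  refine Eq.trans ?_ (hinv d⁻¹ _)
  refine congrArg m (Subtype.ext (funext fun γ => congrArg f.1 ?_))
  change Homotopic.Quotient.trans γ p = Homotopic.Quotient.trans (d⁻¹⁻¹ * γ) q
  rw [inv_inv]
  change Homotopic.Quotient.trans γ p = (Homotopic.Quotient.trans γ (p.trans q.symm)).trans q
  simp [Homotopic.Quotient.trans_assoc]

variable [PathConnectedSpace X]

variable (m) in
/-- The mean on the path classes from `x₀` to `y` induced by an invariant mean `m` on the
fundamental group; the choice of the path from `x₀` to `y` is immaterial. -/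
def pathMean (y : X) : boundedFunctions (Homotopic.Quotient x₀ y) →ₗ[ℝ] ℝ :=
  meanAlong m (Homotopic.Quotient.mk (PathConnectedSpace.somePath x₀ y))

lemma pathMean_boundedComp_trans (hinv : ∀ γ f, m (leftTranslate γ f) = m f)
    (q : Homotopic.Quotient y z) (f : boundedFunctions (Homotopic.Quotient x₀ z)) :
    pathMean m y (boundedComp (fun r => r.trans q) f) = pathMean m z f := by
  rw [pathMean, ← meanAlong_trans, pathMean, meanAlong_eq_meanAlong hinv]

end Averaging

section Lifting

open Path

lemma homotopic_of_range_subset {X : Type*} [TopologicalSpace X] {A : Set X}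
    [SimplyConnectedSpace A] {x y : X} {p q : Path x y} (hp : Set.range p ⊆ A)
    (hq : Set.range q ⊆ A) : p.Homotopic q := by
  let restrict (r : Path x y) (hr : Set.range r ⊆ A) :
      Path (⟨x, hp p.source_mem_range⟩ : A) ⟨y, hp p.target_mem_range⟩ :=
    { toFun := fun t => ⟨r t, hr ⟨t, rfl⟩⟩
      source' := Subtype.ext r.source
      target' := Subtype.ext r.target }
  exact (SimplyConnectedSpace.paths_homotopic (restrict p hp) (restrict q hq)).map
    ⟨Subtype.val, continuous_subtype_val⟩

variable {V : Type*} {K : AbstractSimplicialComplex V} {s : Finset V} {m n : ℕ}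

lemma vert_injective : Function.Injective (OrderedSimplex.vert (K := K) (n := n)) := by
  rintro ⟨v, _⟩ ⟨w, _⟩ rfl
  rfl

lemma pair_vert_mem_faces [DecidableEq V] (e : K.OrderedSimplex n) (i j : Fin (n + 1)) :
    {e.vert i, e.vert j} ∈ K.faces :=
  (K.isRelLowerSet_faces e.mem).2 (Finset.insert_subset (by simp) (by simp))
    (Finset.insert_nonempty _ _)

variable [Fintype V]

variable (K s) in
/-- The closed simplex of the geometric realization spanned by a set of vertices. -/
def closedSimplex : Set K.Realization :=
  {x | ∀ v ∉ s, x.1 v = 0}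

lemma convex_image_val_closedSimplex (hs : s ∈ K.faces) :
    Convex ℝ (Subtype.val '' closedSimplex K s) := by
  rintro _ ⟨x, hx, rfl⟩ _ ⟨y, hy, rfl⟩ a b ha hb hab
  have hsupp : ∀ v ∉ s, (a • x.1 + b • y.1) v = 0 := fun v hv => by simp [hx v hv, hy v hv]
  have hsum : ∑ v, (a • x.1 + b • y.1) v = 1 := by
    simp [Finset.sum_add_distrib, ← Finset.mul_sum, x.2.2.1, y.2.2.1, hab]
  have hnonneg : ∀ v, 0 ≤ (a • x.1 + b • y.1) v := fun v =>
    add_nonneg (mul_nonneg ha (x.2.1 v)) (mul_nonneg hb (y.2.1 v))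
  exact ⟨⟨a • x.1 + b • y.1, hnonneg, hsum, s, hs, hsupp⟩, hsupp, rfl⟩

lemma vertexPoint_mem_closedSimplex [DecidableEq V] {v : V} (hv : v ∈ s) :
    K.vertexPoint v ∈ closedSimplex K s :=
  fun _ hw => Pi.single_eq_of_ne (ne_of_mem_of_not_mem hv hw).symm 1

lemma contractibleSpace_closedSimplex (hs : s ∈ K.faces) :
    ContractibleSpace (closedSimplex K s) := by
  classical
  obtain ⟨v, hv⟩ := (K.isRelLowerSet_faces hs).1
  have := (convex_image_val_closedSimplex hs).contractibleSpace
    ⟨_, K.vertexPoint v, vertexPoint_mem_closedSimplex hv, rfl⟩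
  exact (Topology.IsEmbedding.subtypeVal.homeomorphImage _).contractibleSpace

variable [DecidableEq V]

lemma range_edgePath_subset_closedSimplex {v w : V} (h : {v, w} ∈ K.faces) (hv : v ∈ s)
    (hw : w ∈ s) : Set.range (K.edgePath h) ⊆ closedSimplex K s := by
  rintro _ ⟨t, rfl⟩ u hu
  change (1 - (t : ℝ)) * (K.vertexPoint v).1 u + (t : ℝ) * (K.vertexPoint w).1 u = 0
  rw [vertexPoint_mem_closedSimplex hv u hu, vertexPoint_mem_closedSimplex hw u hu]
  simp

lemma mk_edgePath_trans {u v w : V} (huv : {u, v} ∈ K.faces) (hvw : {v, w} ∈ K.faces)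
    (huw : {u, w} ∈ K.faces) (hs : s ∈ K.faces) (hu : u ∈ s) (hv : v ∈ s) (hw : w ∈ s) :
    (Homotopic.Quotient.mk (K.edgePath huv)).trans (Homotopic.Quotient.mk (K.edgePath hvw)) =
      Homotopic.Quotient.mk (K.edgePath huw) := by
  have := contractibleSpace_closedSimplex hs
  rw [← Homotopic.Quotient.mk_trans, Homotopic.Quotient.eq]
  refine homotopic_of_range_subset (A := closedSimplex K s) ?_
    (range_edgePath_subset_closedSimplex huw hu hw)
  rw [Path.trans_range]
  exact Set.union_subset (range_edgePath_subset_closedSimplex huv hu hv)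
    (range_edgePath_subset_closedSimplex hvw hv hw)

variable {x₀ : K.Realization}

/-- The homotopy class of the edge of `e` from its `i`-th to its `j`-th vertex. -/
def edgeClass (e : K.OrderedSimplex n) (i j : Fin (n + 1)) :
    Homotopic.Quotient (K.vertexPoint (e.vert i)) (K.vertexPoint (e.vert j)) :=
  Homotopic.Quotient.mk (K.edgePath (pair_vert_mem_faces e i j))

lemma edgeClass_trans (e : K.OrderedSimplex n) (i j l : Fin (n + 1)) :
    (edgeClass e i j).trans (edgeClass e j l) = edgeClass e i l :=
  mk_edgePath_trans _ _ _ e.mem (by simp) (by simp) (by simp)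

/-- The lift of `e` to the universal cover whose zeroth vertex is the point given by `p`. -/
def liftSimplex (e : K.OrderedSimplex n) (p : Homotopic.Quotient x₀ (K.vertexPoint (e.vert 0))) :
    (K.universalCover x₀).OrderedSimplex n where
  vert := ⟨fun i => ⟨e.vert i, p.trans (edgeClass e 0 i)⟩, fun _ _ h =>
    e.vert.injective (congrArg CoverVertex.base h)⟩
  mem := by
    refine ⟨?_, ?_, ?_⟩
    · simp only [Finset.coe_map, Finset.coe_univ, Set.image_univ]
      rintro _ ⟨i, rfl⟩ _ ⟨j, rfl⟩ hij
      rw [e.vert.injective hij]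
    · convert e.mem using 1
      ext v
      simp only [Finset.mem_image, Finset.mem_map, Finset.mem_univ, true_and,
        exists_exists_eq_and]
      rfl
    · simp only [Finset.mem_map, Finset.mem_univ, true_and]
      rintro _ ⟨i, rfl⟩ _ ⟨j, rfl⟩
      refine ⟨pair_vert_mem_faces e i j, ?_⟩
      change p.trans (edgeClass e 0 j) = (p.trans (edgeClass e 0 i)).trans (edgeClass e i j)
      rw [Homotopic.Quotient.trans_assoc, edgeClass_trans]

lemma proj_liftSimplex (e : K.OrderedSimplex n)
    (p : Homotopic.Quotient x₀ (K.vertexPoint (e.vert 0))) : (liftSimplex e p).proj = e := rfl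

lemma proj_surjective [PathConnectedSpace K.Realization] (x₀ : K.Realization) :
    Function.Surjective (OrderedSimplex.proj (x₀ := x₀) (n := n)) := fun e =>
  ⟨liftSimplex e (Homotopic.Quotient.mk (PathConnectedSpace.somePath x₀ _)),
    proj_liftSimplex e _⟩

lemma face_liftSimplex (e : K.OrderedSimplex n)
    (p : Homotopic.Quotient x₀ (K.vertexPoint (e.vert 0))) (f : Fin (m + 1) ↪ Fin (n + 1)) :
    (liftSimplex e p).face f = liftSimplex (e.face f) (p.trans (edgeClass e 0 (f 0))) := by
  refine vert_injective (DFunLike.ext _ _ fun i => ?_)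
  change (⟨e.vert (f i), p.trans (edgeClass e 0 (f i))⟩ : K.CoverVertex x₀) =
    ⟨e.vert (f i), (p.trans (edgeClass e 0 (f 0))).trans (edgeClass e (f 0) (f i))⟩
  rw [Homotopic.Quotient.trans_assoc, edgeClass_trans]

end Lifting

section Transfer

variable {V : Type*}

/-- The simplicial coboundary, restricted to bounded functions on ordered simplices. -/
def boundedCoboundary (K : AbstractSimplicialComplex V) (k : ℕ) :
    boundedFunctions (K.OrderedSimplex k) →ₗ[ℝ] boundedFunctions (K.OrderedSimplex (k + 1)) :=
  ∑ i : Fin (k + 2), (-1 : ℝ) ^ (i : ℕ) • boundedComp fun e => e.face (Fin.succAboveEmb i)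

lemma coe_boundedCoboundary {K : AbstractSimplicialComplex V} {k : ℕ}
    (b : boundedFunctions (K.OrderedSimplex k)) :
    (boundedCoboundary K k b : K.OrderedSimplex (k + 1) → ℝ) = K.coboundary k b := by
  ext e
  simp [boundedCoboundary, coboundary, boundedComp]

variable [Fintype V] [DecidableEq V] {K : AbstractSimplicialComplex V}
  [PathConnectedSpace K.Realization] {x₀ : K.Realization} {k n : ℕ}
  (m : boundedFunctions (FundamentalGroup K.Realization x₀) →ₗ[ℝ] ℝ)

/-- The transfer of bounded cochains from the universal cover to the base: the value at a simplex
is the mean of the values at its lifts. -/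
def averageCochain (k : ℕ) : boundedFunctions ((K.universalCover x₀).OrderedSimplex k) →ₗ[ℝ]
    (K.OrderedSimplex k → ℝ) :=
  LinearMap.pi fun e => pathMean m (K.vertexPoint (e.vert 0)) ∘ₗ boundedComp (liftSimplex e)

variable {m}

lemma averageCochain_face (hinv : ∀ γ f, m (leftTranslate γ f) = m f)
    (b : boundedFunctions ((K.universalCover x₀).OrderedSimplex k)) (e : K.OrderedSimplex n)
    (f : Fin (k + 1) ↪ Fin (n + 1)) :
    averageCochain m k b (e.face f) = pathMean m (K.vertexPoint (e.vert 0))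
      (boundedComp (fun p => (liftSimplex e p).face f) b) := by
  simp only [face_liftSimplex]
  exact (pathMean_boundedComp_trans hinv (edgeClass e 0 (f 0))
    (boundedComp (liftSimplex (e.face f)) b)).symm

lemma averageCochain_mem_cochains (hinv : ∀ γ f, m (leftTranslate γ f) = m f)
    {b : boundedFunctions ((K.universalCover x₀).OrderedSimplex k)}
    (hb : b.1 ∈ (K.universalCover x₀).cochains k) : averageCochain m k b ∈ K.cochains k := by
  intro e s
  rw [averageCochain_face hinv, ← smul_eq_mul, averageCochain, LinearMap.pi_apply,
    LinearMap.comp_apply, ← map_smul]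
  exact congrArg (pathMean m _) (Subtype.ext (funext fun p => hb (liftSimplex e p) s))

lemma coboundary_averageCochain (hinv : ∀ γ f, m (leftTranslate γ f) = m f)
    (b : boundedFunctions ((K.universalCover x₀).OrderedSimplex k)) :
    K.coboundary k (averageCochain m k b) =
      averageCochain m (k + 1) (boundedCoboundary (K.universalCover x₀) k b) := by
  ext e
  simp only [coboundary, LinearMap.coe_mk, AddHom.coe_mk, averageCochain_face hinv]
  simp only [averageCochain, boundedCoboundary, LinearMap.pi_apply, LinearMap.comp_apply,
    LinearMap.sum_apply, LinearMap.smul_apply, map_sum, map_smul, smul_eq_mul]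
  rfl

lemma averageCochain_eq_of_eq_comp_proj (hone : m (boundedOne _) = 1)
    {b : boundedFunctions ((K.universalCover x₀).OrderedSimplex k)} {a : K.OrderedSimplex k → ℝ}
    (hb : b.1 = a ∘ OrderedSimplex.proj) : averageCochain m k b = a := by
  ext e
  have hconst : boundedComp (liftSimplex e) b = a e • boundedOne _ :=
    Subtype.ext (funext fun p => (congrFun hb _).trans (mul_one _).symm)
  have hmean : pathMean m (K.vertexPoint (e.vert 0)) (boundedOne _) = 1 := hone
  rw [averageCochain, LinearMap.pi_apply, LinearMap.comp_apply, hconst, map_smul, hmean,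
    smul_eq_mul, mul_one]

lemma mem_coboundaries_of_coboundary_eq_comp_proj (hone : m (boundedOne _) = 1)
    (hinv : ∀ γ f, m (leftTranslate γ f) = m f)
    {b : (K.universalCover x₀).OrderedSimplex k → ℝ} (hb : b ∈ (K.universalCover x₀).cochains k)
    (hbdd : b ∈ boundedFunctions _) {a : K.OrderedSimplex (k + 1) → ℝ}
    (ha : (K.universalCover x₀).coboundary k b = a ∘ OrderedSimplex.proj) :
    a ∈ K.coboundaries (k + 1) := by
  refine ⟨averageCochain m k ⟨b, hbdd⟩, averageCochain_mem_cochains hinv hb, ?_⟩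
  rw [coboundary_averageCochain hinv]
  exact averageCochain_eq_of_eq_comp_proj hone ((coe_boundedCoboundary _).trans ha)

end Transfer

section Integration

variable {V : Type*} {K : AbstractSimplicialComplex V} {k : ℕ}

lemma integral_mem_cochains (β : K.DiffForm k) : β.integral ∈ K.cochains k := by
  intro e s
  have hface : ∀ x ∈ modelSimplex k, (β.form (e.face s.toEmbedding) x fun i => Pi.single i 1) =
      ((Equiv.Perm.sign s : ℤ) : ℝ) * β.form e (modelMap s x) fun i => Pi.single i 1 :=
    fun x hx => by
      rw [β.compatible e s.toEmbedding x hx]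
      exact alternating_modelMapLinear_perm (β.form e (modelMap s x)).toAlternatingMap s
  rw [DiffForm.integral, setIntegral_congr_fun (measurableSet_modelSimplex k) hface,
    integral_const_mul,
    setIntegral_comp_modelMap_perm s fun x => β.form e x fun i => Pi.single i 1, DiffForm.integral]

lemma coboundary_integral {β : K.DiffForm k} {η : K.DiffForm (k + 1)} (h : β.IsPrimitive η) :
    K.coboundary k β.integral = η.integral := by
  ext e
  have hface (i : Fin (k + 2)) : β.integral (e.face (Fin.succAboveEmb i)) =
      ∫ y in modelSimplex k, β.form e (modelMap i.succAbove y) fun l =>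
        modelMapLinear i.succAbove (Pi.single l 1) :=
    setIntegral_congr_fun (measurableSet_modelSimplex k) fun y hy => by
      rw [β.compatible e (Fin.succAboveEmb i) y hy]
      rfl
  have hη : η.integral e = ∫ x in modelSimplex (k + 1),
      extDerivWithin (β.form e) (modelSimplex (k + 1)) x (fun i => Pi.single i 1) :=
    setIntegral_congr_fun (measurableSet_modelSimplex (k + 1)) fun x hx => by rw [h e x hx]
  rw [hη, stokes_modelSimplex ((β.smooth e).of_le (by exact_mod_cast le_top))]
  simp only [coboundary, LinearMap.coe_mk, AddHom.coe_mk, hface, smul_eq_mul]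

/-- The `k`-dimensional Riemannian volume of a `k`-simplex with respect to the metric `g`. -/
def simplexVolume (g : K.Metric) (e : K.OrderedSimplex k) : ℝ :=
  ∫ x in modelSimplex k, √(LinearMap.BilinForm.toMatrix' (g.inner e x).toBilinForm).det

lemma integrableOn_volumeDensity (g : K.Metric) (e : K.OrderedSimplex k) :
    IntegrableOn (fun x => √(LinearMap.BilinForm.toMatrix' (g.inner e x).toBilinForm).det)
      (modelSimplex k) := by
  refine ContinuousOn.integrableOn_compact (isCompact_modelSimplex k) ?_
  refine (Real.continuous_sqrt.comp continuous_id.matrix_det).comp_continuousOn ?_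
  refine continuousOn_pi.2 fun i => continuousOn_pi.2 fun j => ?_
  simp only [LinearMap.BilinForm.toMatrix'_apply]
  exact ((g.smooth e).continuousOn.clm_apply continuousOn_const).clm_apply continuousOn_const

lemma abs_integral_le_simplexVolume_mul {g : K.Metric} {β : K.DiffForm k} {e : K.OrderedSimplex k}
    {C : ℝ} (hC : ∀ x ∈ modelSimplex k, ∀ v : Fin k → Fin k → ℝ,
      (∀ i j, g.inner e x (v i) (v j) = if i = j then 1 else 0) → |β.form e x v| ≤ C) :
    |β.integral e| ≤ simplexVolume g e * C := by
  rw [simplexVolume, ← integral_mul_const, ← Real.norm_eq_abs]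
  refine norm_integral_le_of_norm_le ((integrableOn_volumeDensity g e).mul_const C) ?_
  filter_upwards [ae_restrict_mem (measurableSet_modelSimplex k)] with x hx
  exact abs_alternating_single_le (β.form e x).toAlternatingMap (B := (g.inner e x).toBilinForm)
    ⟨g.symm e x hx⟩ (g.pos e x hx) (hC x hx)

lemma finite_orderedSimplex [Finite V] (K : AbstractSimplicialComplex V) (k : ℕ) :
    Finite (K.OrderedSimplex k) :=
  Finite.of_injective _ vert_injective

lemma integral_mem_boundedFunctions [Fintype V] [DecidableEq V] {x₀ : K.Realization}
    {g : K.Metric} {β : (K.universalCover x₀).DiffForm k} (hβ : β.IsBounded (g.pullback x₀)) :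
    β.integral ∈ boundedFunctions ((K.universalCover x₀).OrderedSimplex k) := by
  obtain ⟨C, hC⟩ := hβ
  have := finite_orderedSimplex K k
  obtain ⟨D, hD⟩ := (Set.finite_range fun e : K.OrderedSimplex k => simplexVolume g e * C).bddAbove
  exact ⟨D, fun e => (abs_integral_le_simplexVolume_mul (hC e)).trans (hD ⟨e.proj, rfl⟩)⟩

end Integration

section Hyperbolic

variable {V : Type*} [Fintype V] [DecidableEq V] {K : AbstractSimplicialComplex V}
  [PathConnectedSpace K.Realization] {x₀ : K.Realization} {g : K.Metric}

lemma integral_eq_zero_of_pullback_eq_zero {k : ℕ} {η : K.DiffForm k}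
    (h : ∀ e, ∀ x ∈ modelSimplex k, (η.pullback x₀).form (n := k) e x = 0) : η.integral = 0 := by
  ext e
  obtain ⟨e, rfl⟩ := proj_surjective x₀ e
  exact setIntegral_eq_zero_of_forall_eq_zero fun x hx => DFunLike.congr_fun (h e x hx) _

lemma integral_mem_coboundaries {m : boundedFunctions (FundamentalGroup K.Realization x₀) →ₗ[ℝ] ℝ}
    (hone : m (boundedOne _) = 1) (hinv : ∀ γ f, m (leftTranslate γ f) = m f) :
    ∀ {k : ℕ} {η : K.DiffForm k}, (η.pullback x₀).HasBoundedPrimitive (g.pullback x₀) →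
      η.integral ∈ K.coboundaries k
  | 0, _, h => integral_eq_zero_of_pullback_eq_zero h
  | _ + 1, _, ⟨_, hprim, hbdd⟩ =>
    mem_coboundaries_of_coboundary_eq_comp_proj hone hinv (integral_mem_cochains _)
      (integral_mem_boundedFunctions hbdd) (coboundary_integral hprim)

end Hyperbolic

end

theorem theorem5p3_general {V : Type*} [Fintype V] [DecidableEq V] (K : AbstractSimplicialComplex V)
    [PathConnectedSpace K.Realization] (x₀ : K.Realization)
    (m : boundedFunctions (FundamentalGroup K.Realization x₀) →ₗ[ℝ] ℝ)
    (hone : m (boundedOne _) = 1) (hinv : ∀ γ f, m (leftTranslate γ f) = m f)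
    (g : K.Metric) (k : ℕ) (α : K.Cohomology k)
    (hα : AbstractSimplicialComplex.IsHyperbolic x₀ g α) : α = 0 := by
  obtain ⟨η, ⟨-, a, ha, rfl⟩, hη⟩ := hα
  rw [AbstractSimplicialComplex.cohomologyClass, Submodule.Quotient.mk_eq_zero,
    Submodule.submoduleOf, Submodule.mem_comap, Submodule.subtype_apply, ha]
  exact integral_mem_coboundaries hone hinv hη

theorem theorem5p3 {V : Type*} [Fintype V] [DecidableEq V] (K : AbstractSimplicialComplex V)
    [PathConnectedSpace K.Realization] (x₀ : K.Realization)
    (hG : IsAmenable (FundamentalGroup K.Realization x₀))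
    (g : K.Metric) (k : ℕ) (α : K.Cohomology k)
    (hα : AbstractSimplicialComplex.IsHyperbolic x₀ g α) : α = 0 := by
  obtain ⟨m, hone, -, hinv⟩ := hG
  exact theorem5p3_general K x₀ m hone hinv g k α hα
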